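/- Let $A\in\mathbb{R}^{n\times n}$ and $B_i\in\mathbb{R}^{n\times m_i}$, $i\in\mathcal N=\{1,\dots,N\}$, and consider the $N$-player differential game with dynamics $\dot x(t)=Ax(t)+\sum_{i=1}^N B_iu_i(t)$, $x(0)=x_0$, in which the players use linear state feedback $u_i(t)=-K_ix(t)$, $K_i\in\mathbb{R}^{m_i\times n}$. Let $\mathcal K$ be the set of profiles $\mathbf K=(K_1,\dots,K_N)$ for which $A-\sum_{i}B_iK_i$ is Hurwitz. For symmetric matrices $Q_i\succeq0$ ($n\times n$), $R_{ii}\succ0$ ($m_i\times m_i$) and $R_{ij}\succeq 0$ ($m_j\times m_j$, $j\ne i$), player $i$ has the cost $$J_i(\mathbf K,x_0)=\int_0^\infty \Big(x(t)'Q_ix(t)+\sum_{j\in\mathcal N}u_j(t)'R_{ij}u_j(t)\Big)\,dt\in[0,\infty].$$ A profile $\mathbf K^*$ is a feedback Nash equilibrium if, for every player $i$, every $x_0\in\mathbb{R}^n$ and every $K_i$ such that the profile $\mathbf K^*_{-i}(K_i)$, obtained from $\mathbf K^*$ by replacing $K_i^*$ with $K_i$, lies in $\mathcal K$, one has $J_i(\mathbf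 K^*,x_0)\le J_i(\mathbf K^*_{-i}(K_i),x_0)$. Let $\mathbf K^\dagger=(K_1^\dagger,\dots,K_N^\dagger)\in\mathcal K$ and $A_{cl}^\dagger=A-\sum_iB_iK_i^\dagger$. Let $\Theta_{\mathbf K^\dagger}$ be the set of tuples $(Q_1,\dots,Q_N,R_{11},\dots,R_{NN},P_1,\dots,P_N)$ of real symmetric matrices for which there are symmetric matrices $R_{ij}$, $j\neq i$, such that, for every $i\in\mathcal N$, $$\begin{aligned} &Q_i+P_iA_{cl}^\dagger+{A_{cl}^\dagger}'P_i+\sum_{j\in\mathcal N}{K_j^\dagger}'R_{ij}K_j^\dagger=0,\qquad R_{ii}K_i^\dagger=B_i'P_i,\\ &R_{ii}\succ0,\qquad R_{ij}\succeq0\ (j\ne i),\qquad Q_i\succeq0,\qquad P_i\succeq0. \end{aligned}$$ Then $\mathbf K^\dagger$ is a feedback Nash equilibrium of the game for some cost matrices $Q_i\succeq0$, $R_{ii}\succ0$, $R_{ij}\succeq0$ ($i,j\in\mathcal N$, $j\neq i$) if and only if $\Theta_{\mathbf K^\dagger}$ is nonempty. -/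

import Mathlib

open scoped Matrix

noncomputable section

namespace LQGame

/-- A real square matrix is Hurwitz if all its complex eigenvalues have negative real part. -/
def IsHurwitz {n : ℕ} (M : Matrix (Fin n) (Fin n) ℝ) : Prop :=
  ∀ s ∈ spectrum ℂ (M.map (fun a : ℝ => (a : ℂ))), s.re < 0

/-- A profile of linear state-feedback gains `K i`, one for each player `i`. -/
abbrev Profile (N n : ℕ) (m : Fin N → ℕ) : Type :=
  ∀ i : Fin N, Matrix (Fin (m i)) (Fin n) ℝ

/-- The closed-loop matrix `A - ∑ i, B i * K i`. -/
def closedLoop {N n : ℕ} {m : Fin N → ℕ} (A : Matrix (Fin n) (Fin n) ℝ)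
    (B : ∀ i : Fin N, Matrix (Fin n) (Fin (m i)) ℝ) (K : Profile N n m) :
    Matrix (Fin n) (Fin n) ℝ :=
  A - ∑ i, B i * K i

/-- The set of stabilizing profiles. -/
def stabilizing {N n : ℕ} {m : Fin N → ℕ} (A : Matrix (Fin n) (Fin n) ℝ)
    (B : ∀ i : Fin N, Matrix (Fin n) (Fin (m i)) ℝ) : Set (Profile N n m) :=
  {K | IsHurwitz (closedLoop A B K)}

/-- The state at time `t` under the profile `K`, started at `x₀`; see `state_zero` and
`hasDerivAt_state`. -/
def state {N n : ℕ} {m : Fin N → ℕ} (A : Matrix (Fin n) (Fin n) ℝ)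
    (B : ∀ i : Fin N, Matrix (Fin n) (Fin (m i)) ℝ) (K : Profile N n m)
    (x₀ : Fin n → ℝ) (t : ℝ) : Fin n → ℝ :=
  NormedSpace.exp (t • closedLoop A B K) *ᵥ x₀

/-- The control `u_i(t) = -K_i x(t)` that player `i` applies under the profile `K`. -/
def control {N n : ℕ} {m : Fin N → ℕ} (A : Matrix (Fin n) (Fin n) ℝ)
    (B : ∀ i : Fin N, Matrix (Fin n) (Fin (m i)) ℝ) (K : Profile N n m)
    (x₀ : Fin n → ℝ) (i : Fin N) (t : ℝ) : Fin (m i) → ℝ :=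
  -(K i *ᵥ state A B K x₀ t)

theorem state_zero {N n : ℕ} {m : Fin N → ℕ} (A : Matrix (Fin n) (Fin n) ℝ)
    (B : ∀ i : Fin N, Matrix (Fin n) (Fin (m i)) ℝ) (K : Profile N n m)
    (x₀ : Fin n → ℝ) : state A B K x₀ 0 = x₀ := by
  simp [state]

section

attribute [local instance] Matrix.linftyOpNormedRing Matrix.linftyOpNormedAlgebra

/-- The state solves the system equation `x' = A x + ∑ i, B_i u_i`. -/
theorem hasDerivAt_state {N n : ℕ} {m : Fin N → ℕ} (A : Matrix (Fin n) (Fin n) ℝ)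
    (B : ∀ i : Fin N, Matrix (Fin n) (Fin (m i)) ℝ) (K : Profile N n m)
    (x₀ : Fin n → ℝ) (t : ℝ) :
    HasDerivAt (state A B K x₀)
      (A *ᵥ state A B K x₀ t + ∑ i, B i *ᵥ control A B K x₀ i t) t := by
  have h := hasDerivAt_exp_smul_const' (𝕂 := ℝ) (closedLoop A B K) t
  let L : Matrix (Fin n) (Fin n) ℝ →L[ℝ] (Fin n → ℝ) :=
    LinearMap.toContinuousLinearMap ((Matrix.mulVecBilin ℝ ℝ).flip x₀)
  have h2 := L.hasFDerivAt.comp_hasDerivAt t h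
  have e : A *ᵥ state A B K x₀ t + ∑ i, B i *ᵥ control A B K x₀ i t
      = (closedLoop A B K * NormedSpace.exp (t • closedLoop A B K)) *ᵥ x₀ := by
    rw [← Matrix.mulVec_mulVec]
    change _ = closedLoop A B K *ᵥ state A B K x₀ t
    have hs : (∑ i, B i * K i) *ᵥ state A B K x₀ t
        = ∑ i, (B i * K i) *ᵥ state A B K x₀ t := by
      ext k
      simp [Matrix.mulVec, dotProduct, Matrix.sum_apply, Finset.sum_mul]
      exact Finset.sum_comm
    rw [closedLoop, Matrix.sub_mulVec, hs]
    simp [control, Matrix.mulVec_neg, sub_eq_add_neg]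
  rw [e]
  exact h2

end

/-- The cost matrices of the game: `Q i` is player `i`'s weight on the state, `R i j` is
player `i`'s weight on the control of player `j`. -/
structure CostMatrices (N n : ℕ) (m : Fin N → ℕ) where
  Q : Fin N → Matrix (Fin n) (Fin n) ℝ
  R : ∀ _ j : Fin N, Matrix (Fin (m j)) (Fin (m j)) ℝ

/-- The admissible cost matrices: `Q i ⪰ 0`, `R i i ≻ 0`, and `R i j ⪰ 0` for `j ≠ i`
(all symmetric). -/
def CostMatrices.Admissible {N n : ℕ} {m : Fin N → ℕ} (c : CostMatrices N n m) : Prop :=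
  (∀ i, (c.Q i).PosSemidef) ∧ (∀ i, (c.R i i).PosDef) ∧
    ∀ i j, j ≠ i → (c.R i j).PosSemidef

/-- The integrand `x' Q_i x + ∑ j, u_j' R_ij u_j` of player `i`'s cost. -/
def runningCost {N n : ℕ} {m : Fin N → ℕ} (c : CostMatrices N n m) (i : Fin N)
    (x : Fin n → ℝ) (u : ∀ j : Fin N, Fin (m j) → ℝ) : ℝ :=
  x ⬝ᵥ c.Q i *ᵥ x + ∑ j, u j ⬝ᵥ c.R i j *ᵥ u j

/-- Player `i`'s cost over `[0, ∞)` under the profile `K` from the initial state `x₀`, with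
value `∞` if the integral diverges. For admissible cost matrices the integrand is
nonnegative. -/
def cost {N n : ℕ} {m : Fin N → ℕ} (A : Matrix (Fin n) (Fin n) ℝ)
    (B : ∀ i : Fin N, Matrix (Fin n) (Fin (m i)) ℝ) (c : CostMatrices N n m) (i : Fin N)
    (K : Profile N n m) (x₀ : Fin n → ℝ) : ENNReal :=
  ∫⁻ t in Set.Ici (0 : ℝ),
    ENNReal.ofReal (runningCost c i (state A B K x₀ t) (fun j => control A B K x₀ j t))

/-- Feedback Nash equilibrium: no player can lower his cost, from any initial state, by
changing his own gain to one for which the resulting profile is stabilizing. -/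
def IsFeedbackNash {N n : ℕ} {m : Fin N → ℕ} (A : Matrix (Fin n) (Fin n) ℝ)
    (B : ∀ i : Fin N, Matrix (Fin n) (Fin (m i)) ℝ) (c : CostMatrices N n m)
    (K : Profile N n m) : Prop :=
  ∀ (i : Fin N) (x₀ : Fin n → ℝ) (Ki : Matrix (Fin (m i)) (Fin n) ℝ),
    Function.update K i Ki ∈ stabilizing A B →
      cost A B c i K x₀ ≤ cost A B c i (Function.update K i Ki) x₀

/-- The tuples `(Q_1, …, Q_N, R_11, …, R_NN, P_1, …, P_N)`. -/
structure FeasibilityTuple (N n : ℕ) (m : Fin N → ℕ) where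
  Q : Fin N → Matrix (Fin n) (Fin n) ℝ
  Rdiag : ∀ i : Fin N, Matrix (Fin (m i)) (Fin (m i)) ℝ
  P : Fin N → Matrix (Fin n) (Fin n) ℝ

/-- The feasibility set of the profile `K`: the tuples that satisfy the constraints for
some choice of the weights `R i j`, `j ≠ i`, that are not listed in the tuple. -/
def feasibilitySet {N n : ℕ} {m : Fin N → ℕ} (A : Matrix (Fin n) (Fin n) ℝ)
    (B : ∀ i : Fin N, Matrix (Fin n) (Fin (m i)) ℝ) (K : Profile N n m) :
    Set (FeasibilityTuple N n m) :=
  {θ | ∃ R : ∀ _ j : Fin N, Matrix (Fin (m j)) (Fin (m j)) ℝ,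
    (∀ i, R i i = θ.Rdiag i) ∧
    ∀ i,
      θ.Q i + θ.P i * closedLoop A B K + (closedLoop A B K)ᵀ * θ.P i
        + ∑ j, (K j)ᵀ * R i j * K j = 0 ∧
      R i i * K i = (B i)ᵀ * θ.P i ∧
      (R i i).PosDef ∧
      (∀ j, j ≠ i → (R i j).PosSemidef) ∧
      (θ.Q i).PosSemidef ∧
      (θ.P i).PosSemidef}

end LQGame

end

/-!
For a stabilizing profile `K` with closed loop `M`, the cost of player `i` is the quadratic form of
the unique solution `P` of the Lyapunov equation `W + P M + Mᵀ P = 0`, where `W` is the matrix of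
the running cost in feedback form (`cost_eq`). This rests on the decay of `exp (t M)` for Hurwitz
`M`: the function `-x(t)' P x(t)` is an antiderivative of the running cost, and it tends to `0`.
Decay also makes the Lyapunov operator injective, hence bijective (`IsHurwitz.exists_lyapunov`),
and makes its solution positive semidefinite when `W` is.

The Nash property thereby becomes a comparison of Lyapunov solutions. Suppose player `i` replaces
`K i` by a stabilizing gain `L`, the Lyapunov solution changes from `P` to `P'`, and `F` is the gain
with `R F = Bᵀ P`, where `R = R i i` and `B = B i`. Completing the square (`lyapunov_sub`) shows
that `P' - P` solves the Lyapunov equation of the new closed loop with weight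
`(L - F)ᵀ R (L - F) - (K i - F)ᵀ R (K i - F)`.

* If `K i = F`, this weight is positive semidefinite, so `P' - P` is too and no deviation pays
  (`isFeedbackNash_of_lyapunov`).
* Conversely, let `L = F + (1 - ε) (K i - F)` with `ε > 0` small; it is stabilizing because the
  Hurwitz matrices form an open set. The weight is then a negative multiple of
  `(K i - F)ᵀ R (K i - F)`, so `P' - P` is negative semidefinite. At an equilibrium it is also
  positive semidefinite, so it vanishes together with the weight, and `K i = F` because `R` is
  positive definite (`IsFeedbackNash.gain_eq`).
-/

open scoped Matrix
open Filter Topology MeasureTheory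

namespace LQGame

/-! ### Decay of the exponential of a Hurwitz matrix -/

section Decay

attribute [local instance] Matrix.linftyOpNormedRing Matrix.linftyOpNormedAlgebra

theorem tendsto_pow_of_spectralRadius_lt_one {𝔸 : Type*} [NormedRing 𝔸] [NormedAlgebra ℂ 𝔸]
    [CompleteSpace 𝔸] {a : 𝔸} (ha : spectralRadius ℂ a < 1) :
    Tendsto (fun k : ℕ => a ^ k) atTop (𝓝 0) := by
  obtain ⟨r, hr, hr1⟩ := ENNReal.lt_iff_exists_nnreal_btwn.mp ha
  have hr1' : r < 1 := by exact_mod_cast hr1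
  have h := (spectrum.pow_nnnorm_pow_one_div_tendsto_nhds_spectralRadius a).eventually_lt_const hr
  refine squeeze_zero_norm' (a := fun k : ℕ => (r : ℝ) ^ k) ?_
    (tendsto_pow_atTop_nhds_zero_of_lt_one r.coe_nonneg (by exact_mod_cast hr1'))
  filter_upwards [h, eventually_gt_atTop 0] with k hk hk0
  have h1 := ENNReal.pow_le_pow_left hk.le (n := k)
  rw [← ENNReal.rpow_natCast, ← ENNReal.rpow_mul, one_div,
    inv_mul_cancel₀ (by exact_mod_cast hk0.ne'), ENNReal.rpow_one] at h1
  exact_mod_cast h1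

theorem exp_mulVec_of_eigenvector {n : ℕ} {C : Matrix (Fin n) (Fin n) ℂ} {v : Fin n → ℂ} {s : ℂ}
    (h : C *ᵥ v = s • v) : NormedSpace.exp C *ᵥ v = Complex.exp s • v := by
  have hp (k : ℕ) : C ^ k *ᵥ v = s ^ k • v := by
    induction k with
    | zero => simp
    | succ k ih => rw [pow_succ, ← Matrix.mulVec_mulVec, h, Matrix.mulVec_smul, ih, smul_smul,
        pow_succ']
  let L : Matrix (Fin n) (Fin n) ℂ →L[ℂ] (Fin n → ℂ) :=
    LinearMap.toContinuousLinearMap ((Matrix.mulVecBilin ℂ ℂ).flip v)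
  have h1 := (NormedSpace.exp_series_hasSum_exp' (𝕂 := ℂ) C).mapL L
  have h2 := (NormedSpace.exp_series_hasSum_exp' (𝕂 := ℂ) s).smul_const v
  rw [← Complex.exp_eq_exp_ℂ] at h2
  refine h1.unique ?_
  convert h2 using 2 with k
  change ((k.factorial : ℂ)⁻¹ • C ^ k) *ᵥ v = _
  rw [Matrix.smul_mulVec, hp, smul_smul, smul_eq_mul]

/-- The inclusion `σ(exp C) ⊆ exp(σ(C))` of the spectral mapping theorem: `C` leaves each eigenspace
of `exp C` invariant, hence has an eigenvector in it. -/
theorem exists_exp_eq_of_mem_spectrum_exp {n : ℕ} {C : Matrix (Fin n) (Fin n) ℂ} {μ : ℂ}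
    (hμ : μ ∈ spectrum ℂ (NormedSpace.exp C)) : ∃ s ∈ spectrum ℂ C, Complex.exp s = μ := by
  rw [← Matrix.spectrum_toLin', ← Module.End.hasEigenvalue_iff_mem_spectrum] at hμ
  have hc : Commute (NormedSpace.exp C).toLin' C.toLin' := by
    have : Commute (NormedSpace.exp C) C := (Commute.refl C).exp_left
    exact this.map Matrix.toLinAlgEquiv'
  have hmap : Set.MapsTo C.toLin' (Module.End.eigenspace (NormedSpace.exp C).toLin' μ)
      (Module.End.eigenspace (NormedSpace.exp C).toLin' μ) :=
    Module.End.mapsTo_genEigenspace_of_comm hc μ 1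
  have : Nontrivial (Module.End.eigenspace (NormedSpace.exp C).toLin' μ) :=
    Submodule.nontrivial_iff_ne_bot.mpr hμ
  obtain ⟨s, hs⟩ := Module.End.exists_eigenvalue (C.toLin'.restrict hmap)
  obtain ⟨w, hw⟩ := hs.exists_hasEigenvector
  have hw0 : (w : Fin n → ℂ) ≠ 0 := by simpa using hw.2
  have hCw : C *ᵥ (w : Fin n → ℂ) = s • (w : Fin n → ℂ) :=
    congrArg Subtype.val hw.apply_eq_smul
  have hEw : NormedSpace.exp C *ᵥ (w : Fin n → ℂ) = μ • (w : Fin n → ℂ) := by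
    simpa using Module.End.mem_eigenspace_iff.mp w.2
  refine ⟨s, ?_, ?_⟩
  · rw [← Matrix.spectrum_toLin', ← Module.End.hasEigenvalue_iff_mem_spectrum]
    exact Module.End.hasEigenvalue_of_hasEigenvector
      ⟨Module.End.mem_eigenspace_iff.mpr (by simpa using hCw), hw0⟩
  · exact smul_left_injective ℂ hw0 ((exp_mulVec_of_eigenvector hCw).symm.trans hEw)

/-- By spectral mapping the complexification of `exp M` has spectral radius less than `1`, so its
powers tend to `0` by Gelfand's formula. -/
theorem IsHurwitz.tendsto_exp_pow {n : ℕ} {M : Matrix (Fin n) (Fin n) ℝ} (hM : IsHurwitz M) :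
    Tendsto (fun k : ℕ => NormedSpace.exp M ^ k) atTop (𝓝 0) := by
  rcases isEmpty_or_nonempty (Fin n) with hn | hn
  · exact tendsto_const_nhds.congr fun k => Subsingleton.elim _ _
  let φ : Matrix (Fin n) (Fin n) ℝ →+* Matrix (Fin n) (Fin n) ℂ := Complex.ofRealHom.mapMatrix
  have hφ : Continuous φ := continuous_id.matrix_map Complex.continuous_ofReal
  have hexp : φ (NormedSpace.exp M) = NormedSpace.exp (M.map (fun a : ℝ => (a : ℂ))) :=
    NormedSpace.map_exp φ hφ M
  have hρ : spectralRadius ℂ (φ (NormedSpace.exp M)) < 1 := by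
    refine spectrum.spectralRadius_lt_of_forall_lt _ (r := 1) fun μ hμ => ?_
    rw [hexp] at hμ
    obtain ⟨s, hs, rfl⟩ := exists_exp_eq_of_mem_spectrum_exp hμ
    rw [← NNReal.coe_lt_coe, coe_nnnorm, Complex.norm_exp, NNReal.coe_one, Real.exp_lt_one_iff]
    exact hM s hs
  have h := tendsto_pow_of_spectralRadius_lt_one hρ
  have hre : Continuous fun C : Matrix (Fin n) (Fin n) ℂ => C.map Complex.re :=
    continuous_id.matrix_map Complex.continuous_re
  have h' := (hre.tendsto 0).comp h
  rw [Matrix.map_zero _ Complex.zero_re] at h'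
  refine h'.congr fun k => ?_
  rw [Function.comp_apply, ← map_pow]
  rfl

theorem IsHurwitz.tendsto_exp_smul {n : ℕ} {M : Matrix (Fin n) (Fin n) ℝ} (hM : IsHurwitz M) :
    Tendsto (fun t : ℝ => NormedSpace.exp (t • M)) atTop (𝓝 0) := by
  have hcont : Continuous fun t : ℝ => ‖NormedSpace.exp (t • M)‖ :=
    (NormedSpace.exp_continuous.comp (continuous_id.smul continuous_const)).norm
  obtain ⟨c, hc⟩ := (isCompact_Icc (a := (0 : ℝ)) (b := 1)).bddAbove_image hcont.continuousOn
  have h := (hM.tendsto_exp_pow.comp (tendsto_nat_floor_atTop (α := ℝ))).norm.const_mul c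
  rw [norm_zero, mul_zero] at h
  refine squeeze_zero_norm' ?_ h
  filter_upwards [eventually_ge_atTop 0] with t ht
  have hsplit : NormedSpace.exp (t • M)
      = NormedSpace.exp ((t - ⌊t⌋₊) • M) * NormedSpace.exp M ^ ⌊t⌋₊ := by
    rw [← Matrix.exp_nsmul, ← Matrix.exp_add_of_commute, ← Nat.cast_smul_eq_nsmul ℝ, ← add_smul,
      sub_add_cancel]
    rw [← Nat.cast_smul_eq_nsmul ℝ]
    exact ((Commute.refl M).smul_left _).smul_right _
  rw [hsplit]
  refine (norm_mul_le _ _).trans (mul_le_mul_of_nonneg_right (hc ?_) (norm_nonneg _))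
  exact Set.mem_image_of_mem _ ⟨sub_nonneg.mpr (Nat.floor_le ht),
    by linarith [Nat.lt_floor_add_one t]⟩

/-- The set of Hurwitz matrices is open, as the spectrum is upper hemicontinuous. -/
theorem IsHurwitz.eventually {n : ℕ} {M : Matrix (Fin n) (Fin n) ℝ} (hM : IsHurwitz M) :
    ∀ᶠ M' in 𝓝 M, IsHurwitz M' := by
  have hre : Continuous fun M : Matrix (Fin n) (Fin n) ℝ => M.map (fun a : ℝ => (a : ℂ)) :=
    continuous_id.matrix_map Complex.continuous_ofReal
  have hopen : IsOpen {s : ℂ | s.re < 0} := isOpen_lt Complex.continuous_re continuous_const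
  have h := upperHemicontinuous_spectrum ℂ (Matrix (Fin n) (Fin n) ℂ)
    (M.map fun a : ℝ => (a : ℂ)) {s : ℂ | s.re < 0} (hopen.mem_nhdsSet.mpr hM)
  filter_upwards [hre.continuousAt.eventually h] with M' hM'
  exact subset_of_mem_nhdsSet hM'

theorem hasDerivAt_exp_smul_mulVec {n : ℕ} (M : Matrix (Fin n) (Fin n) ℝ) (x : Fin n → ℝ)
    (t : ℝ) : HasDerivAt (fun t : ℝ => NormedSpace.exp (t • M) *ᵥ x)
      (M *ᵥ (NormedSpace.exp (t • M) *ᵥ x)) t := by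
  have h := hasDerivAt_exp_smul_const' (𝕂 := ℝ) M t
  let L : Matrix (Fin n) (Fin n) ℝ →L[ℝ] (Fin n → ℝ) :=
    LinearMap.toContinuousLinearMap ((Matrix.mulVecBilin ℝ ℝ).flip x)
  rw [Matrix.mulVec_mulVec]
  exact L.hasFDerivAt.comp_hasDerivAt t h

theorem IsHurwitz.tendsto_exp_smul_mulVec {n : ℕ} {M : Matrix (Fin n) (Fin n) ℝ}
    (hM : IsHurwitz M) (x : Fin n → ℝ) :
    Tendsto (fun t : ℝ => NormedSpace.exp (t • M) *ᵥ x) atTop (𝓝 0) := by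
  have hc : Continuous fun E : Matrix (Fin n) (Fin n) ℝ => E *ᵥ x :=
    continuous_id.matrix_mulVec continuous_const
  simpa [Function.comp_def] using (hc.tendsto 0).comp hM.tendsto_exp_smul

end Decay

theorem hasDerivAt_bilin_exp {n : ℕ} (M P : Matrix (Fin n) (Fin n) ℝ) (x y : Fin n → ℝ) (t : ℝ) :
    HasDerivAt (fun t : ℝ => NormedSpace.exp (t • M) *ᵥ x ⬝ᵥ P *ᵥ (NormedSpace.exp (t • M) *ᵥ y))
      (NormedSpace.exp (t • M) *ᵥ x ⬝ᵥ
        (P * M + Mᵀ * P) *ᵥ (NormedSpace.exp (t • M) *ᵥ y)) t := by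
  have hx := hasDerivAt_exp_smul_mulVec M x t
  have hy := (LinearMap.toContinuousLinearMap P.mulVecLin).hasFDerivAt.comp_hasDerivAt t
    (hasDerivAt_exp_smul_mulVec M y t)
  have h := HasDerivAt.fun_sum (u := Finset.univ) fun i _ =>
    (hasDerivAt_pi.mp hx i).mul (hasDerivAt_pi.mp hy i)
  refine HasDerivAt.congr_deriv h ?_
  rw [Finset.sum_add_distrib, Matrix.add_mulVec, dotProduct_add, add_comm]
  congr 1
  · simp [dotProduct, Matrix.mulVec_mulVec, Matrix.mul_assoc]
  · rw [← Matrix.mulVec_mulVec, Matrix.dotProduct_mulVec _ Mᵀ, Matrix.vecMul_transpose]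
    rfl

theorem IsHurwitz.tendsto_bilin_exp {n : ℕ} {M : Matrix (Fin n) (Fin n) ℝ} (hM : IsHurwitz M)
    (P : Matrix (Fin n) (Fin n) ℝ) (x y : Fin n → ℝ) :
    Tendsto (fun t : ℝ => NormedSpace.exp (t • M) *ᵥ x ⬝ᵥ P *ᵥ (NormedSpace.exp (t • M) *ᵥ y))
      atTop (𝓝 0) := by
  have hc : Continuous fun p : (Fin n → ℝ) × (Fin n → ℝ) => p.1 ⬝ᵥ P *ᵥ p.2 :=
    continuous_fst.dotProduct (continuous_const.matrix_mulVec continuous_snd)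
  have h := (hc.tendsto (0, 0)).comp
    ((hM.tendsto_exp_smul_mulVec x).prodMk_nhds (hM.tendsto_exp_smul_mulVec y))
  simpa [Function.comp_def] using h

/-! ### The Lyapunov equation -/

section Lyapunov

variable {n : ℕ} {M : Matrix (Fin n) (Fin n) ℝ}

/-- The homogeneous Lyapunov equation has only the zero solution: `x(t)' X y(t)` is constant along
the flow of `M`, and tends to `0`. -/
theorem IsHurwitz.eq_zero_of_lyapunov (hM : IsHurwitz M) {X : Matrix (Fin n) (Fin n) ℝ}
    (hX : X * M + Mᵀ * X = 0) : X = 0 := by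
  have h0 (x y : Fin n → ℝ) : x ⬝ᵥ X *ᵥ y = 0 := by
    have hd (t : ℝ) := hasDerivAt_bilin_exp M X x y t
    simp only [hX, Matrix.zero_mulVec, dotProduct_zero] at hd
    have hconst := is_const_of_deriv_eq_zero (fun t => (hd t).differentiableAt)
      (fun t => (hd t).deriv)
    have h := tendsto_nhds_unique (hM.tendsto_bilin_exp X x y)
      (tendsto_const_nhds.congr fun t => hconst 0 t)
    simpa using h.symm
  ext i j
  simpa using h0 (Pi.single i 1) (Pi.single j 1)

theorem IsHurwitz.exists_lyapunov (hM : IsHurwitz M) {W : Matrix (Fin n) (Fin n) ℝ}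
    (hW : W.IsHermitian) :
    ∃ P : Matrix (Fin n) (Fin n) ℝ, P.IsHermitian ∧ W + (P * M + Mᵀ * P) = 0 := by
  let T : Matrix (Fin n) (Fin n) ℝ →ₗ[ℝ] Matrix (Fin n) (Fin n) ℝ :=
    LinearMap.mulRight ℝ M + LinearMap.mulLeft ℝ Mᵀ
  have hinj : Function.Injective T :=
    (injective_iff_map_eq_zero T).mpr fun X hX => hM.eq_zero_of_lyapunov hX
  obtain ⟨P, hP⟩ := LinearMap.injective_iff_surjective.mp hinj (-W)
  have hP' : P * M + Mᵀ * P = -W := hP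
  refine ⟨P, ?_, by rw [hP', add_neg_cancel]⟩
  -- `Pᵀ` solves the same equation, so it equals `P` by uniqueness.
  refine hinj (Eq.trans ?_ hP.symm)
  have h := congrArg Matrix.transpose hP'
  rw [Matrix.transpose_neg, ← Matrix.conjTranspose_eq_transpose_of_trivial W, hW.eq] at h
  change Pᴴ * M + Mᵀ * Pᴴ = -W
  rw [← h, Matrix.conjTranspose_eq_transpose_of_trivial, Matrix.transpose_add,
    Matrix.transpose_mul, Matrix.transpose_mul, Matrix.transpose_transpose, add_comm]

theorem hasDerivAt_neg_lyapunov {W P : Matrix (Fin n) (Fin n) ℝ}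
    (hP : W + (P * M + Mᵀ * P) = 0) (x : Fin n → ℝ) (t : ℝ) :
    HasDerivAt
      (fun t : ℝ => -(NormedSpace.exp (t • M) *ᵥ x ⬝ᵥ P *ᵥ (NormedSpace.exp (t • M) *ᵥ x)))
      (NormedSpace.exp (t • M) *ᵥ x ⬝ᵥ W *ᵥ (NormedSpace.exp (t • M) *ᵥ x)) t := by
  refine (hasDerivAt_bilin_exp M P x x t).neg.congr_deriv ?_
  rw [eq_neg_of_add_eq_zero_right hP, Matrix.neg_mulVec, dotProduct_neg, neg_neg]

theorem IsHurwitz.lyapunov_quadratic_nonneg (hM : IsHurwitz M)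
    {W P : Matrix (Fin n) (Fin n) ℝ} (hW : W.PosSemidef) (hP : W + (P * M + Mᵀ * P) = 0)
    (x : Fin n → ℝ) : 0 ≤ x ⬝ᵥ P *ᵥ x := by
  have hmono := monotone_of_hasDerivAt_nonneg (hasDerivAt_neg_lyapunov hP x)
    fun t => by simpa using hW.dotProduct_mulVec_nonneg (NormedSpace.exp (t • M) *ᵥ x)
  have h := hmono.ge_of_tendsto (hM.tendsto_bilin_exp P x x).neg 0
  simpa using h

theorem IsHurwitz.lyapunov_posSemidef (hM : IsHurwitz M) {W P : Matrix (Fin n) (Fin n) ℝ}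
    (hW : W.PosSemidef) (hPh : P.IsHermitian) (hP : W + (P * M + Mᵀ * P) = 0) :
    P.PosSemidef :=
  .of_dotProduct_mulVec_nonneg hPh fun x => hM.lyapunov_quadratic_nonneg hW hP x

theorem IsHurwitz.lintegral_quadratic (hM : IsHurwitz M) {W P : Matrix (Fin n) (Fin n) ℝ}
    (hW : W.PosSemidef) (hP : W + (P * M + Mᵀ * P) = 0) (x : Fin n → ℝ) :
    ∫⁻ t in Set.Ici (0 : ℝ), ENNReal.ofReal
      (NormedSpace.exp (t • M) *ᵥ x ⬝ᵥ W *ᵥ (NormedSpace.exp (t • M) *ᵥ x))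
      = ENNReal.ofReal (x ⬝ᵥ P *ᵥ x) := by
  have hpos (t : ℝ) :
      0 ≤ NormedSpace.exp (t • M) *ᵥ x ⬝ᵥ W *ᵥ (NormedSpace.exp (t • M) *ᵥ x) := by
    simpa using hW.dotProduct_mulVec_nonneg (NormedSpace.exp (t • M) *ᵥ x)
  have hlim := (hM.tendsto_bilin_exp P x x).neg
  have hint := integrableOn_Ioi_deriv_of_nonneg' (a := 0)
    (fun t _ => hasDerivAt_neg_lyapunov hP x t) (fun t _ => hpos t) hlim
  rw [← restrict_Ioi_eq_restrict_Ici,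
    ← ofReal_integral_eq_lintegral_ofReal hint (Eventually.of_forall hpos),
    integral_Ioi_of_hasDerivAt_of_nonneg' (fun t _ => hasDerivAt_neg_lyapunov hP x t)
      (fun t _ => hpos t) hlim]
  simp

end Lyapunov

/-! ### Unilateral deviations -/

section Deviation

/-- Completing the square. If `P` and `P'` solve the Lyapunov equations for the gains `K` and `L` of
one player (`S` collects the state weight and the weights of the other players), and `F` satisfies
the stationarity condition `R F = Bᵀ P`, then `P' - P` solves the Lyapunov equation of the closed
loop under `L` for a difference of two squares. -/
theorem lyapunov_sub {n k : ℕ} {M P P' S : Matrix (Fin n) (Fin n) ℝ}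
    {B : Matrix (Fin n) (Fin k) ℝ} {R : Matrix (Fin k) (Fin k) ℝ}
    {K L F : Matrix (Fin k) (Fin n) ℝ} (hR : R.IsHermitian) (hPh : P.IsHermitian)
    (hF : R * F = Bᵀ * P)
    (hP : S + Kᵀ * R * K + (P * M + Mᵀ * P) = 0)
    (hP' : S + Lᵀ * R * L + (P' * (M + B * (K - L)) + (M + B * (K - L))ᵀ * P') = 0) :
    ((L - F)ᵀ * R * (L - F) - (K - F)ᵀ * R * (K - F))
      + ((P' - P) * (M + B * (K - L)) + (M + B * (K - L))ᵀ * (P' - P)) = 0 := by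
  have hPB : P * B = Fᵀ * R := by
    have h := congrArg Matrix.transpose hF
    rw [Matrix.transpose_mul, Matrix.transpose_mul, Matrix.transpose_transpose,
      ← Matrix.conjTranspose_eq_transpose_of_trivial R, hR.eq,
      ← Matrix.conjTranspose_eq_transpose_of_trivial P, hPh.eq] at h
    exact h.symm
  rw [← sub_eq_zero.mpr (hP'.trans hP.symm)]
  have e1 : P * (B * (K - L)) = Fᵀ * R * (K - L) := by rw [← Matrix.mul_assoc, hPB]
  have e2 : (B * (K - L))ᵀ * P = (K - L)ᵀ * (R * F) := by
    rw [Matrix.transpose_mul, Matrix.mul_assoc, hF]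
  rw [Matrix.transpose_add, sub_mul, mul_sub, mul_add P, add_mul _ _ P, e1, e2]
  simp only [Matrix.transpose_sub, Matrix.sub_mul, Matrix.mul_sub, Matrix.mul_assoc]
  abel

variable {N n : ℕ} {m : Fin N → ℕ}

/-- The part of player `i`'s quadratic running cost in feedback form that does not depend on his own
gain `K i`. -/
def CostMatrices.restWeight (c : CostMatrices N n m) (i : Fin N) (K : Profile N n m) :
    Matrix (Fin n) (Fin n) ℝ :=
  c.Q i + ∑ j ∈ Finset.univ.erase i, (K j)ᵀ * c.R i j * K j

/-- The matrix of player `i`'s running cost under the profile `K`, as a quadratic form in the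
state. -/
def CostMatrices.weight (c : CostMatrices N n m) (i : Fin N) (K : Profile N n m) :
    Matrix (Fin n) (Fin n) ℝ :=
  c.Q i + ∑ j, (K j)ᵀ * c.R i j * K j

theorem CostMatrices.weight_eq (c : CostMatrices N n m) (i : Fin N) (K : Profile N n m) :
    c.weight i K = c.restWeight i K + (K i)ᵀ * c.R i i * K i := by
  rw [weight, restWeight, add_assoc, Finset.sum_erase_add _ _ (Finset.mem_univ i)]

theorem CostMatrices.weight_update (c : CostMatrices N n m) (i : Fin N) (K : Profile N n m)
    (L : Matrix (Fin (m i)) (Fin n) ℝ) :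
    c.weight i (Function.update K i L) = c.restWeight i K + Lᵀ * c.R i i * L := by
  have h : c.restWeight i (Function.update K i L) = c.restWeight i K := by
    refine congrArg (c.Q i + ·) (Finset.sum_congr rfl fun j hj => ?_)
    rw [Function.update_of_ne (Finset.ne_of_mem_erase hj)]
  rw [weight_eq, h, Function.update_self]

theorem CostMatrices.Admissible.posSemidef {c : CostMatrices N n m} (hc : c.Admissible)
    (i j : Fin N) : (c.R i j).PosSemidef := by
  rcases eq_or_ne j i with rfl | h
  · exact (hc.2.1 j).posSemidef
  · exact hc.2.2 i j h

theorem CostMatrices.Admissible.weight_posSemidef {c : CostMatrices N n m} (hc : c.Admissible)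
    (i : Fin N) (K : Profile N n m) : (c.weight i K).PosSemidef :=
  (hc.1 i).add <| Matrix.posSemidef_sum _ fun j _ =>
    (hc.posSemidef i j).conjTranspose_mul_mul_same (K j)

theorem closedLoop_update (A : Matrix (Fin n) (Fin n) ℝ)
    (B : ∀ i : Fin N, Matrix (Fin n) (Fin (m i)) ℝ) (K : Profile N n m) (i : Fin N)
    (L : Matrix (Fin (m i)) (Fin n) ℝ) :
    closedLoop A B (Function.update K i L) = closedLoop A B K + B i * (K i - L) := by
  have h : ∑ j ∈ Finset.univ.erase i, B j * Function.update K i L j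
      = ∑ j ∈ Finset.univ.erase i, B j * K j :=
    Finset.sum_congr rfl fun j hj => by
      rw [Function.update_of_ne (Finset.ne_of_mem_erase hj)]
  rw [closedLoop, closedLoop, ← Finset.sum_erase_add _ _ (Finset.mem_univ i),
    ← Finset.sum_erase_add _ (fun j => B j * K j) (Finset.mem_univ i), h,
    Function.update_self, Matrix.mul_sub]
  abel

theorem runningCost_feedback (c : CostMatrices N n m) (i : Fin N) (K : Profile N n m)
    (x : Fin n → ℝ) : runningCost c i x (fun j => -(K j *ᵥ x)) = x ⬝ᵥ c.weight i K *ᵥ x := by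
  rw [runningCost, CostMatrices.weight, Matrix.add_mulVec, dotProduct_add, Matrix.sum_mulVec,
    dotProduct_sum]
  congr 1
  refine Finset.sum_congr rfl fun j _ => ?_
  rw [Matrix.mulVec_neg, neg_dotProduct_neg, Matrix.mul_assoc, ← Matrix.mulVec_mulVec,
    Matrix.dotProduct_mulVec x, Matrix.vecMul_transpose, Matrix.mulVec_mulVec]

theorem cost_eq {A : Matrix (Fin n) (Fin n) ℝ}
    {B : ∀ i : Fin N, Matrix (Fin n) (Fin (m i)) ℝ} {c : CostMatrices N n m}
    (hc : c.Admissible) {i : Fin N} {K : Profile N n m} (hK : K ∈ stabilizing A B)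
    {P : Matrix (Fin n) (Fin n) ℝ}
    (hP : c.weight i K + (P * closedLoop A B K + (closedLoop A B K)ᵀ * P) = 0)
    (x : Fin n → ℝ) : cost A B c i K x = ENNReal.ofReal (x ⬝ᵥ P *ᵥ x) := by
  rw [← IsHurwitz.lintegral_quadratic hK (hc.weight_posSemidef i K) hP x]
  exact lintegral_congr fun t => congrArg ENNReal.ofReal (runningCost_feedback c i K _)

/-- If every gain satisfies the stationarity condition for the player's own Lyapunov solution, then
a unilateral deviation adds the nonnegative square `(L - K i)ᵀ R (L - K i)` to the Lyapunov
weight. -/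
theorem isFeedbackNash_of_lyapunov {A : Matrix (Fin n) (Fin n) ℝ}
    {B : ∀ i : Fin N, Matrix (Fin n) (Fin (m i)) ℝ} {c : CostMatrices N n m}
    (hc : c.Admissible) {K : Profile N n m} (hK : K ∈ stabilizing A B)
    {P : Fin N → Matrix (Fin n) (Fin n) ℝ} (hPh : ∀ i, (P i).IsHermitian)
    (hP : ∀ i, c.weight i K + (P i * closedLoop A B K + (closedLoop A B K)ᵀ * P i) = 0)
    (hB : ∀ i, c.R i i * K i = (B i)ᵀ * P i) : IsFeedbackNash A B c K := by
  intro i x L hL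
  obtain ⟨P', -, hP'⟩ := IsHurwitz.exists_lyapunov hL
    (hc.weight_posSemidef i (Function.update K i L)).isHermitian
  rw [cost_eq hc hK (hP i), cost_eq hc hL hP']
  apply ENNReal.ofReal_le_ofReal
  have hPi := hP i
  rw [c.weight_eq] at hPi
  rw [c.weight_update, closedLoop_update] at hP'
  have hsub := lyapunov_sub (hc.2.1 i).isHermitian (hPh i) (hB i) hPi hP'
  rw [sub_self, Matrix.mul_zero, sub_zero, ← closedLoop_update] at hsub
  have h := IsHurwitz.lyapunov_quadratic_nonneg hL
    ((hc.posSemidef i i).conjTranspose_mul_mul_same (L - K i)) hsub x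
  rwa [Matrix.sub_mulVec, dotProduct_sub, sub_nonneg] at h

/-- A small step from `K i` towards any gain `F` keeps the profile stabilizing. -/
theorem exists_stabilizing_lineMap {A : Matrix (Fin n) (Fin n) ℝ}
    {B : ∀ i : Fin N, Matrix (Fin n) (Fin (m i)) ℝ} {K : Profile N n m}
    (hK : K ∈ stabilizing A B) (i : Fin N) (F : Matrix (Fin (m i)) (Fin n) ℝ) :
    ∃ ε : ℝ, 0 < ε ∧ ε < 1 ∧
      Function.update K i (F + (1 - ε) • (K i - F)) ∈ stabilizing A B := by
  have hcont : Continuous fun ε : ℝ => closedLoop A B K + B i * (ε • (K i - F)) := by fun_prop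
  have h0 : Tendsto (fun ε : ℝ => closedLoop A B K + B i * (ε • (K i - F))) (𝓝[>] 0)
      (𝓝 (closedLoop A B K)) := by
    have h := (hcont.tendsto 0).mono_left (nhdsWithin_le_nhds (s := Set.Ioi 0))
    simpa using h
  have hev := h0.eventually (IsHurwitz.eventually hK)
  obtain ⟨ε, hε, hε0, hε1⟩ := (hev.and (Ioo_mem_nhdsGT one_pos)).exists
  refine ⟨ε, hε0, hε1, ?_⟩
  change IsHurwitz _
  rw [closedLoop_update]
  convert hε using 3
  rw [sub_smul, one_smul]
  abel

/-- At an equilibrium each gain satisfies the stationarity condition: otherwise a small step from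
`K i` towards the gain `F` given by `R F = Bᵀ P` lowers the cost. -/
theorem IsFeedbackNash.gain_eq {A : Matrix (Fin n) (Fin n) ℝ}
    {B : ∀ i : Fin N, Matrix (Fin n) (Fin (m i)) ℝ} {c : CostMatrices N n m}
    (hc : c.Admissible) {K : Profile N n m} (hK : K ∈ stabilizing A B)
    (hN : IsFeedbackNash A B c K) {i : Fin N} {P : Matrix (Fin n) (Fin n) ℝ}
    (hPh : P.IsHermitian)
    (hP : c.weight i K + (P * closedLoop A B K + (closedLoop A B K)ᵀ * P) = 0) :
    c.R i i * K i = (B i)ᵀ * P := by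
  have hR := hc.2.1 i
  set F := (c.R i i)⁻¹ * ((B i)ᵀ * P)
  have hF : c.R i i * F = (B i)ᵀ * P :=
    Matrix.mul_nonsing_inv_cancel_left _ _ ((Matrix.isUnit_iff_isUnit_det _).mp hR.isUnit)
  obtain ⟨ε, hε0, hε1, hL⟩ := exists_stabilizing_lineMap hK i F
  set L := F + (1 - ε) • (K i - F) with hLdef
  obtain ⟨P', hPh', hP'⟩ := IsHurwitz.exists_lyapunov hL
    (hc.weight_posSemidef i (Function.update K i L)).isHermitian
  have hpsd' := IsHurwitz.lyapunov_posSemidef hL (hc.weight_posSemidef i _) hPh' hP'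
  -- The equilibrium inequality; `P'` is positive semidefinite, so `ENNReal.ofReal` loses nothing.
  have hge : (P' - P).PosSemidef := by
    refine .of_dotProduct_mulVec_nonneg (hPh'.sub hPh) fun x => ?_
    have h := hN i x L hL
    rw [cost_eq hc hK hP, cost_eq hc hL hP', ENNReal.ofReal_le_ofReal_iff
      (by simpa using hpsd'.dotProduct_mulVec_nonneg x)] at h
    rw [star_trivial, Matrix.sub_mulVec, dotProduct_sub]
    exact sub_nonneg.mpr h
  rw [c.weight_eq] at hP
  rw [c.weight_update, closedLoop_update] at hP'
  have hsub := lyapunov_sub hR.isHermitian hPh hF hP hP'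
  rw [← closedLoop_update] at hsub
  set W := (K i - F)ᵀ * c.R i i * (K i - F) with hW
  have hLF : (L - F)ᵀ * c.R i i * (L - F) = ((1 - ε) * (1 - ε)) • W := by
    rw [hLdef, add_sub_cancel_left, Matrix.transpose_smul, Matrix.smul_mul, Matrix.smul_mul,
      Matrix.mul_smul, smul_smul]
  -- The weight of the Lyapunov equation for `P' - P` is `-(1 - (1 - ε)²) W`.
  have hδ : 0 < 1 - (1 - ε) * (1 - ε) := by nlinarith
  have hWpsd : W.PosSemidef := hR.posSemidef.conjTranspose_mul_mul_same (K i - F)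
  have hneg : (1 - (1 - ε) * (1 - ε)) • W + (-(P' - P) * closedLoop A B (Function.update K i L)
      + (closedLoop A B (Function.update K i L))ᵀ * -(P' - P)) = 0 := by
    rw [hLF] at hsub
    rw [sub_smul, one_smul, Matrix.neg_mul, Matrix.mul_neg, ← neg_eq_zero, ← hsub]
    abel
  have hle := IsHurwitz.lyapunov_posSemidef hL (hWpsd.smul hδ.le) (hPh'.sub hPh).neg hneg
  -- Both `P' - P` and its negative are positive semidefinite, so the trace vanishes.
  have hzero : P' - P = 0 := by
    refine hge.trace_eq_zero_iff.mp (le_antisymm ?_ hge.trace_nonneg)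
    simpa using hle.trace_nonneg
  have hW0 : W = 0 := by
    simpa [hzero, hδ.ne'] using hneg
  have hKF : K i - F = 0 := by
    by_contra hne
    obtain ⟨x, hx⟩ : ∃ x, (K i - F) *ᵥ x ≠ 0 := by
      by_contra! hx
      exact hne (Matrix.ext_of_mulVec_single fun j => by rw [hx, Matrix.zero_mulVec])
    have hpos := hR.dotProduct_mulVec_pos hx
    have hq : x ⬝ᵥ W *ᵥ x = 0 := by rw [hW0, Matrix.zero_mulVec, dotProduct_zero]
    rw [hW, Matrix.mul_assoc, ← Matrix.mulVec_mulVec, Matrix.dotProduct_mulVec x,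
      Matrix.vecMul_transpose, ← Matrix.mulVec_mulVec] at hq
    exact hpos.ne' hq
  rw [sub_eq_zero.mp hKF, hF]

end Deviation

end LQGame

theorem proposition1 (N n : ℕ) (m : Fin N → ℕ) (A : Matrix (Fin n) (Fin n) ℝ)
    (B : ∀ i : Fin N, Matrix (Fin n) (Fin (m i)) ℝ) (K : LQGame.Profile N n m)
    (hK : K ∈ LQGame.stabilizing A B) :
    (∃ c : LQGame.CostMatrices N n m, c.Admissible ∧ LQGame.IsFeedbackNash A B c K) ↔
      (LQGame.feasibilitySet A B K).Nonempty := by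
  have hcomm (Q X Y S : Matrix (Fin n) (Fin n) ℝ) : Q + X + Y + S = Q + S + (X + Y) := by abel
  constructor
  · rintro ⟨c, hc, hN⟩
    choose P hPh hP using fun i =>
      LQGame.IsHurwitz.exists_lyapunov hK (hc.weight_posSemidef i K).isHermitian
    refine ⟨⟨c.Q, fun i => c.R i i, P⟩, c.R, fun i => rfl, fun i =>
      ⟨(hcomm _ _ _ _).trans (hP i), hN.gain_eq hc hK (hPh i) (hP i), hc.2.1 i, hc.2.2 i, hc.1 i,
        LQGame.IsHurwitz.lyapunov_posSemidef hK (hc.weight_posSemidef i K) (hPh i) (hP i)⟩⟩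
  · rintro ⟨θ, R, -, hθ⟩
    have hc : LQGame.CostMatrices.Admissible ⟨θ.Q, R⟩ :=
      ⟨fun i => (hθ i).2.2.2.2.1, fun i => (hθ i).2.2.1, fun i => (hθ i).2.2.2.1⟩
    exact ⟨⟨θ.Q, R⟩, hc, LQGame.isFeedbackNash_of_lyapunov hc hK
      (fun i => (hθ i).2.2.2.2.2.isHermitian) (fun i => (hcomm _ _ _ _).symm.trans (hθ i).1)
      fun i => (hθ i).2.1⟩
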